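/- Let $A_r,E_r\in\mathbb{R}^{n\times n}$, $B_r\in\mathbb{R}^{n\times m}$, $C_r\in\mathbb{R}^{(p+m)\times n}$, $D_r\in\mathbb{R}^{(p+m)\times m}$, with $E_r$ invertible and all generalized eigenvalues of the pencil $A_r-sE_r$ in the open left half-plane $\mathbb{C}^-$. A real-rational matrix is called stable if it has no poles in $(\mathbb{C}\setminus\mathbb{C}^-)\cup\{\infty\}$. A stable right coprime factorization (RCF) of a real-rational $p\times m$ matrix $\mathbf G$ is a pair of stable real-rational matrices $\mathbf N$ ($p\times m$), $\mathbf M$ ($m\times m$, $\det\mathbf M\not\equiv0$) with $\mathbf G=\mathbf N\mathbf M^{-1}$ for which there are stable real-rational $\widetilde{\mathbf X},\widetilde{\mathbf Y}$ with $\widetilde{\mathbf Y}\mathbf M-\widetilde{\mathbf X}\mathbf N=I$; it is normalized (NRCF) if moreover $\mathbf N^{\top}(-s)\mathbf N(s)+\mathbf M^{\top}(-s)\mathbf M(s)=I$. Suppose that $$\begin{bmatrix}\mathbf N(s)\\ \mathbf M(s)\end{bmatrix}=C_r(sE_r-A_r)^{-1}B_r+D_r$$ and that $(\mathbf N,\mathbf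 M)$ is a stable RCF of $\mathbf G=\mathbf N\mathbf M^{-1}$ ($\mathbf G$ possibly improper). Let $H_r\in\mathbb{R}^{m\times m}$ be invertible with $H_r^{\top}H_r=D_r^{\top}D_r$. Then: (a) The generalized continuous-time algebraic Riccati equation $$E_r^{\top}X_rA_r+A_r^{\top}X_rE_r+C_r^{\top}C_r-(E_r^{\top}X_rB_r+C_r^{\top}D_r)(D_r^{\top}D_r)^{-1}(B_r^{\top}X_rE_r+D_r^{\top}C_r)=0$$ has a symmetric stabilizing solution $X_r\in\mathbb{R}^{n\times n}$, i.e. a symmetric solution for which the feedback $F_r:=-(D_r^{\top}D_r)^{-1}(B_r^{\top}X_rE_r+D_r^{\top}C_r)$ makes all generalized eigenvalues of $A_r+B_rF_r-sE_r$ lie in $\mathbb{C}^-$. (b) For any such $X_r$ with its feedback $F_r$, the matrix $\mathbf G_0(s):=-H_rF_r(sE_r-A_r)^{-1}B_r+H_r$ is invertible (as a matrix of real-rational functions), and $\widehat{\mathbf N}:=\mathbf N\mathbf G_0^{-1}$, $\widehat{\mathbf M}:=\mathbf M\mathbf G_0^{-1}$ form a stable NRCF of $\mathbf G$. -/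

import Mathlib

open Matrix Polynomial

noncomputable section

namespace Descriptor

/-- The open left half-plane, as a subset of the extended complex plane. -/
def openLHP : Set (OnePoint ℂ) := (fun z : ℂ => (z : OnePoint ℂ)) '' {z : ℂ | z.re < 0}

/-- A transfer function matrix with `m` inputs and `p` outputs: entries are real-rational
functions of the indeterminate `s = RatFunc.X`. -/
abbrev TFM (p m : Type*) := Matrix p m (RatFunc ℝ)

/-- A real constant matrix, viewed as a transfer function matrix. -/
def const {p m : Type*} (K : Matrix p m ℝ) : TFM p m := K.map RatFunc.C

/-- The poles (finite and infinite) of a transfer function matrix: the zeros of the reduced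
denominators of its entries, and `∞` if some entry is not proper. -/
def poles {p m : Type*} (G : TFM p m) : Set (OnePoint ℂ) :=
  {w | ∃ z : ℂ, w = (z : OnePoint ℂ) ∧ ∃ i j, aeval z (G i j).denom = 0} ∪
  {w | w = OnePoint.infty ∧ ∃ i j, (G i j).denom.natDegree < (G i j).num.natDegree}

/-- Membership in `RH_∞`: all the poles lie in the open left half-plane. -/
def IsStable {p m : Type*} (G : TFM p m) : Prop := poles G ⊆ openLHP

/-- The pencil `A - s E` is regular: its determinant is not the zero polynomial. -/
def IsRegularPencil {n : Type*} [Fintype n] [DecidableEq n] (A E : Matrix n n ℝ) : Prop :=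
  (A.map (C : ℝ →+* ℝ[X]) - (X : ℝ[X]) • E.map (C : ℝ →+* ℝ[X])).det ≠ 0

/-- The generalized eigenvalues of the pencil `A - s E`: the finite ones, and `∞` when `E` is
singular. -/
def genEigenvalues {n : Type*} [Fintype n] [DecidableEq n] (A E : Matrix n n ℝ) :
    Set (OnePoint ℂ) :=
  {w | ∃ z : ℂ, w = (z : OnePoint ℂ) ∧
    (A.map (algebraMap ℝ ℂ) - z • E.map (algebraMap ℝ ℂ)).det = 0} ∪
  {w | w = OnePoint.infty ∧ E.det = 0}

/-- The pencil `A - s E` is regular and all its generalized eigenvalues, finite or infinite,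
lie in the open left half-plane. -/
def IsStablePencil {n : Type*} [Fintype n] [DecidableEq n] (A E : Matrix n n ℝ) : Prop :=
  IsRegularPencil A E ∧ genEigenvalues A E ⊆ openLHP

/-- The transfer function matrix `C (s E - A)⁻¹ B + D` of a descriptor realization. -/
def realize {n p m : Type*} [Fintype n] [DecidableEq n]
    (A E : Matrix n n ℝ) (B : Matrix n m ℝ) (C : Matrix p n ℝ) (D : Matrix p m ℝ) : TFM p m :=
  const C * ((RatFunc.X : RatFunc ℝ) • const E - const A)⁻¹ * const B + const D

/-- The substitution `s ↦ -s` on real-rational functions. -/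
def negArg : RatFunc ℝ →ₐ[ℝ] RatFunc ℝ :=
  RatFunc.mapAlgHom (Polynomial.algEquivAevalNegX : ℝ[X] ≃ₐ[ℝ] ℝ[X]).toAlgHom
    (nonZeroDivisors_le_comap_nonZeroDivisors_of_injective _
      (Polynomial.algEquivAevalNegX : ℝ[X] ≃ₐ[ℝ] ℝ[X]).injective)

/-- `(N, M)` is a stable right coprime factorization of `G = N M⁻¹`. -/
structure IsStableRCF {p m : Type*} [Fintype p] [Fintype m] [DecidableEq m]
    (G N : TFM p m) (M : TFM m m) : Prop where
  stable_num : IsStable N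
  stable_den : IsStable M
  det_den_ne_zero : M.det ≠ 0
  factorization : G = N * M⁻¹
  coprime : ∃ (Xt : TFM m p) (Yt : TFM m m), IsStable Xt ∧ IsStable Yt ∧ Yt * M - Xt * N = 1

/-- `(N, M)` is a stable normalized right coprime factorization of `G`, that is, a stable right
coprime factorization with `Nᵀ(-s) N(s) + Mᵀ(-s) M(s) = I`. -/
structure IsStableNRCF {p m : Type*} [Fintype p] [Fintype m] [DecidableEq m]
    (G N : TFM p m) (M : TFM m m) : Prop extends IsStableRCF G N M where
  normalized : (N.map negArg)ᵀ * N + (M.map negArg)ᵀ * M = 1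

/-- The generalized continuous-time algebraic Riccati equation in the unknown `X`. -/
def GCARE {n q m : Type*} [Fintype n] [Fintype q] [Fintype m] [DecidableEq m]
    (A E : Matrix n n ℝ) (B : Matrix n m ℝ) (C : Matrix q n ℝ) (D : Matrix q m ℝ)
    (X : Matrix n n ℝ) : Prop :=
  Eᵀ * X * A + Aᵀ * X * E + Cᵀ * C
    - (Eᵀ * X * B + Cᵀ * D) * (Dᵀ * D)⁻¹ * (Bᵀ * X * E + Dᵀ * C) = 0

/-- The feedback `F = -(Dᵀ D)⁻¹ (Bᵀ X E + Dᵀ C)` associated with `X`. -/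
def feedback {n q m : Type*} [Fintype n] [Fintype q] [Fintype m] [DecidableEq m]
    (E : Matrix n n ℝ) (B : Matrix n m ℝ) (C : Matrix q n ℝ) (D : Matrix q m ℝ)
    (X : Matrix n n ℝ) : Matrix m n ℝ :=
  -((Dᵀ * D)⁻¹ * (Bᵀ * X * E + Dᵀ * C))

/-- `X` is a symmetric stabilizing solution of the Riccati equation. -/
structure IsStabilizingSolution {n q m : Type*} [Fintype n] [DecidableEq n] [Fintype q]
    [Fintype m] [DecidableEq m]
    (A E : Matrix n n ℝ) (B : Matrix n m ℝ) (C : Matrix q n ℝ) (D : Matrix q m ℝ)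
    (X : Matrix n n ℝ) : Prop where
  symm : X.IsSymm
  solves : GCARE A E B C D X
  stabilizing : IsStablePencil (A + B * feedback E B C D X) E

end Descriptor

end

/-! Write T for the stacked matrix [N; M]. The Bezout identity says that T has a stable left
inverse, so T(z) is injective for every z in the closed right half-plane, and hence the realization
has no zero there (`eq_zero_of_leftInverse`).

This yields the stabilizing Riccati solution. After `E` is absorbed into `A` and `B`, the state
matrix is Hurwitz, so Kleinman's iteration can start from zero feedback. Each step solves a Lyapunov
equation for the cost of the current feedback (`IsCost.exists_next`). The costs decrease and stay
positive semidefinite, so they converge to a Riccati solution (`exists_posSemidef_lyapunov_gain`).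
Stability of the closed loop need not survive the limit by itself, but an unstable eigenvector of
the limiting closed loop would be a zero of the realization (`exists_stabilizing_posSemidef`).

For (b), the Riccati equation gives the spectral factorization T~T = G₀~G₀, where ~ is the
para-conjugate (`paraconj_realize_mul_realize`). The inverse of G₀ has state matrix A + BF, so it is
stable because X is stabilizing (`realize_mul_realize_closedLoop`). Thus G₀ is a unit over the
stable rational functions, and right multiplication by its inverse keeps coprimeness and turns T~T
into the identity (`IsStableRCF.normalize`). -/

namespace Descriptor

/-! ### Stable rational functions and their evaluation at a point. -/

/-- The ring of real-rational functions that are regular at `z`. -/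
def regularAt (z : ℂ) : Subring (RatFunc ℝ) where
  carrier := {f | aeval z f.denom ≠ 0}
  mul_mem' {f g} hf hg h := by
    have := aeval_eq_zero_of_dvd_aeval_eq_zero (RatFunc.denom_mul_dvd f g) h
    rw [map_mul, mul_eq_zero] at this
    exact this.elim hf hg
  add_mem' {f g} hf hg h := by
    have := aeval_eq_zero_of_dvd_aeval_eq_zero (RatFunc.denom_add_dvd f g) h
    rw [map_mul, mul_eq_zero] at this
    exact this.elim hf hg
  one_mem' := by simp
  zero_mem' := by simp
  neg_mem' {f} hf h := by
    have hd : (-f).denom ∣ f.denom := by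
      rw [RatFunc.denom_dvd f.denom_ne_zero]
      exact ⟨-f.num, by rw [map_neg, neg_div, RatFunc.num_div_denom]⟩
    exact hf (aeval_eq_zero_of_dvd_aeval_eq_zero hd h)

lemma mem_regularAt {z : ℂ} {f : RatFunc ℝ} : f ∈ regularAt z ↔ aeval z f.denom ≠ 0 := Iff.rfl

/-- Evaluation at `z` of the rational functions that are regular there. -/
noncomputable def evalAt (z : ℂ) : regularAt z →+* ℂ where
  toFun f := RatFunc.eval (algebraMap ℝ ℂ) z f.1
  map_one' := by simp
  map_zero' := by simp
  map_mul' f g := RatFunc.eval_mul _ _ f.2 g.2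
  map_add' f g := RatFunc.eval_add _ _ f.2 g.2

/-- A matrix of rational functions, evaluated at `z`. -/
noncomputable def evalMatrix {p m : Type*} (z : ℂ) (G : TFM p m) : Matrix p m ℂ :=
  G.map (RatFunc.eval (algebraMap ℝ ℂ) z)

lemma evalMatrix_mul {p q m : Type*} [Fintype q] {z : ℂ} {G : TFM p q} {K : TFM q m}
    (hG : ∀ i j, G i j ∈ regularAt z) (hK : ∀ i j, K i j ∈ regularAt z) :
    evalMatrix z (G * K) = evalMatrix z G * evalMatrix z K := by
  ext i j
  have h := map_sum (evalAt z) (fun k => (⟨G i k, hG i k⟩ * ⟨K k j, hK k j⟩ : regularAt z))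
    Finset.univ
  simp only [map_mul] at h
  have hs : ((∑ k, ⟨G i k, hG i k⟩ * ⟨K k j, hK k j⟩ : regularAt z) : RatFunc ℝ) =
      ∑ k, G i k * K k j := by push_cast; rfl
  simp only [evalMatrix, map_apply, mul_apply, ← hs]
  exact h

lemma evalMatrix_add {p m : Type*} {z : ℂ} {G K : TFM p m}
    (hG : ∀ i j, G i j ∈ regularAt z) (hK : ∀ i j, K i j ∈ regularAt z) :
    evalMatrix z (G + K) = evalMatrix z G + evalMatrix z K := by
  ext i j
  exact RatFunc.eval_add _ _ (hG i j) (hK i j)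

@[simp]
lemma evalMatrix_const {p m : Type*} (z : ℂ) (K : Matrix p m ℝ) :
    evalMatrix z (const K) = K.map (algebraMap ℝ ℂ) := by
  ext i j
  simp [evalMatrix, const]

@[simp]
lemma evalMatrix_one {m : Type*} [DecidableEq m] (z : ℂ) :
    evalMatrix z (1 : TFM m m) = 1 := by
  ext i j
  by_cases h : i = j <;> simp [evalMatrix, one_apply, h]

lemma const_mem_regularAt {p m : Type*} (z : ℂ) (K : Matrix p m ℝ) (i : p) (j : m) :
    const K i j ∈ regularAt z := by
  simp [mem_regularAt, const]

/-- The proper real-rational functions whose poles lie in the open left half-plane. -/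
def stableSubring : Subring (RatFunc ℝ) where
  carrier := {f | (∀ z : ℂ, 0 ≤ z.re → f ∈ regularAt z) ∧ (f = 0 ∨ f.intDegree ≤ 0)}
  mul_mem' {f g} hf hg := by
    refine ⟨fun z hz => mul_mem (hf.1 z hz) (hg.1 z hz), ?_⟩
    by_cases h : f = 0
    · simp [h]
    by_cases h' : g = 0
    · simp [h']
    right
    have h1 := hf.2.resolve_left h
    have h2 := hg.2.resolve_left h'
    rw [RatFunc.intDegree_mul h h']
    omega
  add_mem' {f g} hf hg := by
    refine ⟨fun z hz => add_mem (hf.1 z hz) (hg.1 z hz), ?_⟩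
    by_cases h : f = 0
    · simpa [h] using hg.2
    by_cases h' : g = 0
    · simpa [h'] using hf.2
    by_cases h'' : f + g = 0
    · exact Or.inl h''
    right
    exact (RatFunc.intDegree_add_le h' h'').trans
      (max_le (hf.2.resolve_left h) (hg.2.resolve_left h'))
  one_mem' := ⟨fun z _ => one_mem _, by simp⟩
  zero_mem' := ⟨fun z _ => zero_mem _, by simp⟩
  neg_mem' {f} hf := ⟨fun z hz => neg_mem (hf.1 z hz), by simpa using hf.2⟩

lemma mem_stableSubring {f : RatFunc ℝ} : f ∈ stableSubring ↔
    (∀ z : ℂ, 0 ≤ z.re → f ∈ regularAt z) ∧ (f = 0 ∨ f.intDegree ≤ 0) := Iff.rfl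

lemma coe_mem_openLHP {z : ℂ} : (z : OnePoint ℂ) ∈ openLHP ↔ z.re < 0 := by
  simp [openLHP]

lemma infty_notMem_openLHP : OnePoint.infty ∉ openLHP := by
  simp [openLHP]

/-- Rephrasing the pole condition as entrywise membership in a subring makes stability closed under
sums and products. -/
lemma isStable_iff {p m : Type*} {G : TFM p m} :
    IsStable G ↔ ∀ i j, G i j ∈ stableSubring := by
  simp only [mem_stableSubring]
  constructor
  · intro h i j
    refine ⟨fun z hz h0 => ?_, ?_⟩
    · exact absurd (coe_mem_openLHP.1 (h (Or.inl ⟨z, rfl, i, j, h0⟩))) (not_lt.2 hz)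
    · by_contra! hc
      refine infty_notMem_openLHP (h (Or.inr ⟨rfl, i, j, ?_⟩))
      have := hc.2
      rw [RatFunc.intDegree] at this
      omega
  · rintro h w (⟨z, rfl, i, j, h0⟩ | ⟨rfl, i, j, h0⟩)
    · rw [coe_mem_openLHP]
      by_contra! hz
      exact (h i j).1 z hz h0
    · rcases (h i j).2 with h2 | h2
      · simp [h2] at h0
      · rw [RatFunc.intDegree] at h2
        omega

lemma IsStable.mem_regularAt {p m : Type*} {G : TFM p m} (h : IsStable G) {z : ℂ}
    (hz : 0 ≤ z.re) (i : p) (j : m) : G i j ∈ regularAt z :=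
  (isStable_iff.1 h i j).1 z hz

lemma isStable_const {p m : Type*} (K : Matrix p m ℝ) : IsStable (const K) := by
  refine isStable_iff.2 fun i j => mem_stableSubring.2 ⟨fun z _ => const_mem_regularAt z K i j, ?_⟩
  simp [const]

lemma IsStable.mul {p q m : Type*} [Fintype q] {G : TFM p q} {K : TFM q m}
    (hG : IsStable G) (hK : IsStable K) : IsStable (G * K) := by
  rw [isStable_iff] at *
  exact fun i j => sum_mem fun k _ => mul_mem (hG i k) (hK k j)

lemma IsStable.add {p m : Type*} {G K : TFM p m}
    (hG : IsStable G) (hK : IsStable K) : IsStable (G + K) := by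
  rw [isStable_iff] at *
  exact fun i j => add_mem (hG i j) (hK i j)

/-! ### The resolvent of a stable pencil. -/

section Pencil

variable {n : Type*} [Fintype n] [DecidableEq n] (A E : Matrix n n ℝ)

/-- The matrix `s E - A` of real-rational functions. -/
noncomputable def pencil : TFM n n := (RatFunc.X : RatFunc ℝ) • const E - const A

/-- The polynomial matrix `s E - A`. -/
noncomputable def polyPencil : Matrix n n ℝ[X] :=
  (X : ℝ[X]) • E.map (C : ℝ →+* ℝ[X]) + (-A).map (C : ℝ →+* ℝ[X])

lemma pencil_eq_map {n : Type*} (A E : Matrix n n ℝ) : pencil A E = (polyPencil A E).map (algebraMap ℝ[X] (RatFunc ℝ)) := by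
  ext i j
  simp [pencil, polyPencil, const, RatFunc.algebraMap_X, RatFunc.algebraMap_C, sub_eq_add_neg,
    mul_comm RatFunc.X]

lemma det_pencil : (pencil A E).det = algebraMap ℝ[X] (RatFunc ℝ) (polyPencil A E).det := by
  rw [pencil_eq_map, RingHom.map_det]
  rfl

/-- A cofactor is the determinant of the pencil with one row replaced by a constant unit vector,
which is again of the form X P + Q. The crude bound suffices, since only properness of the resolvent
is needed. -/
lemma natDegree_adjugate_polyPencil (i j : n) :
    ((polyPencil A E).adjugate i j).natDegree ≤ Fintype.card n := by
  have h : (polyPencil A E).updateRow j (Pi.single i 1) =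
      (X : ℝ[X]) • (E.updateRow j 0).map (C : ℝ →+* ℝ[X]) +
        ((-A).updateRow j (Pi.single i 1)).map (C : ℝ →+* ℝ[X]) := by
    ext k l
    by_cases hk : k = j
    · subst hk
      by_cases hl : l = i
      · subst hl; simp
      · simp [hl]
    · simp [hk, polyPencil]
  rw [adjugate_apply, h]
  exact natDegree_det_X_add_C_le _ _

variable {A E}

lemma natDegree_det_polyPencil (hE : IsUnit E) :
    (polyPencil A E).det.natDegree = Fintype.card n := by
  refine le_antisymm (natDegree_det_X_add_C_le _ _) (le_natDegree_of_ne_zero ?_)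
  rw [polyPencil, coeff_det_X_add_C_card]
  exact ((isUnit_iff_isUnit_det E).1 hE).ne_zero

lemma IsStablePencil.det_polyPencil_ne_zero (hA : IsStablePencil A E) :
    (polyPencil A E).det ≠ 0 := by
  have h : A.map (C : ℝ →+* ℝ[X]) - (X : ℝ[X]) • E.map (C : ℝ →+* ℝ[X]) = -polyPencil A E := by
    ext1 i j
    simp [polyPencil]
    ring
  have := hA.1
  rw [IsRegularPencil, h, det_neg] at this
  exact right_ne_zero_of_mul this

lemma aeval_det_polyPencil (z : ℂ) : aeval z (polyPencil A E).det =
    (-(A.map (algebraMap ℝ ℂ) - z • E.map (algebraMap ℝ ℂ))).det := by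
  have h : aeval z (polyPencil A E).det =
    ((polyPencil A E).map (aeval z : ℝ[X] →ₐ[ℝ] ℂ)).det := AlgHom.map_det _ _
  rw [h]
  congr 1
  ext i j
  simp [polyPencil]
  ring

lemma IsStablePencil.isUnit_pencil (hA : IsStablePencil A E) : IsUnit (pencil A E) := by
  rw [isUnit_iff_isUnit_det, det_pencil, isUnit_iff_ne_zero]
  exact RatFunc.algebraMap_ne_zero hA.det_polyPencil_ne_zero

/-- By Cramer's rule each reduced denominator divides the determinant of the pencil, whose roots are
the finite generalized eigenvalues. There is no pole at infinity because that determinant has full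
degree when `E` is invertible. -/
lemma IsStablePencil.isStable_inv (hA : IsStablePencil A E) (hE : IsUnit E) :
    IsStable (pencil A E)⁻¹ := by
  have hd := hA.det_polyPencil_ne_zero
  have key : ∀ i j, (pencil A E)⁻¹ i j = algebraMap ℝ[X] (RatFunc ℝ) ((polyPencil A E).adjugate i j)
      / algebraMap ℝ[X] (RatFunc ℝ) (polyPencil A E).det := by
    intro i j
    have : (pencil A E).adjugate =
        (polyPencil A E).adjugate.map (algebraMap ℝ[X] (RatFunc ℝ)) := by
      rw [pencil_eq_map]
      exact (RingHom.map_adjugate _ _).symm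
    rw [inv_def, det_pencil, this, Matrix.smul_apply, map_apply, Ring.inverse_eq_inv', smul_eq_mul,
      div_eq_inv_mul]
  refine isStable_iff.2 fun i j => mem_stableSubring.2 ⟨fun z hz h0 => ?_, ?_⟩
  · have hdvd := (RatFunc.denom_dvd hd).2 ⟨_, key i j⟩
    have h1 := aeval_eq_zero_of_dvd_aeval_eq_zero hdvd h0
    rw [aeval_det_polyPencil, det_neg] at h1
    have h2 := (mul_eq_zero.1 h1).resolve_left (by simp)
    exact absurd (coe_mem_openLHP.1 (hA.2 (Or.inl ⟨z, rfl, h2⟩))) (not_lt.2 hz)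
  · by_cases h : (polyPencil A E).adjugate i j = 0
    · left; simp [key, h]
    · right
      rw [key, RatFunc.intDegree_div (RatFunc.algebraMap_ne_zero h) (RatFunc.algebraMap_ne_zero hd),
        RatFunc.intDegree_polynomial, RatFunc.intDegree_polynomial, natDegree_det_polyPencil hE]
      have := natDegree_adjugate_polyPencil A E i j
      omega

lemma pencil_mem_regularAt {n : Type*} {A E : Matrix n n ℝ} (z : ℂ) (i j : n) : pencil A E i j ∈ regularAt z := by
  refine sub_mem (mul_mem ?_ (const_mem_regularAt z E i j)) (const_mem_regularAt z A i j)
  simp [mem_regularAt]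

lemma evalMatrix_pencil {n : Type*} {A E : Matrix n n ℝ} (z : ℂ) : evalMatrix z (pencil A E) =
    z • E.map (algebraMap ℝ ℂ) - A.map (algebraMap ℝ ℂ) := by
  ext i j
  simp only [evalMatrix, pencil_eq_map, map_apply, RatFunc.eval_algebraMap]
  simp [polyPencil, sub_eq_add_neg, mul_comm z]

end Pencil

/-! ### Lyapunov equations via the Cayley transform. -/

section Lyapunov

variable {n : Type*} [Fintype n] [DecidableEq n]

/-- All the eigenvalues of the real matrix `A` lie in the open left half-plane. -/
def Hurwitz (A : Matrix n n ℝ) : Prop :=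
  ∀ (z : ℂ) (v : n → ℂ), A.map (algebraMap ℝ ℂ) *ᵥ v = z • v → v ≠ 0 → z.re < 0

-- Gelfand's formula: the norm of S^k is eventually below r^k for some r < 1 above the spectral
-- radius.
open scoped Matrix.Norms.Operator in
lemma tendsto_pow_of_spectrum_lt_one (S : Matrix n n ℂ) (hS : ∀ z ∈ spectrum ℂ S, ‖z‖ < 1) :
    Filter.Tendsto (fun k : ℕ => S ^ k) Filter.atTop (nhds 0) := by
  rcases isEmpty_or_nonempty n with hn | hn
  · exact tendsto_const_nhds.congr fun k => Subsingleton.elim _ _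
  have h1 : spectralRadius ℂ S < ((1 : NNReal) : ENNReal) :=
    spectrum.spectralRadius_lt_of_forall_lt S fun z hz => hS z hz
  obtain ⟨r, hr1, hr2⟩ := ENNReal.lt_iff_exists_nnreal_btwn.1 h1
  have hr2' : r < 1 := by exact_mod_cast hr2
  have h2 := (spectrum.pow_nnnorm_pow_one_div_tendsto_nhds_spectralRadius S).eventually_lt_const hr1
  refine tendsto_zero_iff_norm_tendsto_zero.2 ?_
  refine squeeze_zero' (Filter.Eventually.of_forall fun k => norm_nonneg _) ?_
    (tendsto_pow_atTop_nhds_zero_of_lt_one r.2 (by exact_mod_cast hr2'))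
  filter_upwards [h2, Filter.eventually_gt_atTop 0] with k hk hk0
  have hk0' : (k : ℝ) ≠ 0 := by exact_mod_cast hk0.ne'
  have h3 := ENNReal.rpow_le_rpow hk.le (Nat.cast_nonneg k : (0 : ℝ) ≤ k)
  rw [← ENNReal.rpow_mul, one_div_mul_cancel hk0', ENNReal.rpow_one, ENNReal.rpow_natCast] at h3
  exact_mod_cast h3

lemma exists_eigenvector_of_mem_spectrum {S : Matrix n n ℂ} {z : ℂ} (hz : z ∈ spectrum ℂ S) :
    ∃ v ≠ 0, S *ᵥ v = z • v := by
  rw [spectrum.mem_iff, isUnit_iff_isUnit_det, isUnit_iff_ne_zero, not_not,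
    ← exists_mulVec_eq_zero_iff] at hz
  obtain ⟨v, hv, h⟩ := hz
  refine ⟨v, hv, ?_⟩
  rw [sub_mulVec, sub_eq_zero, algebraMap_eq_diagonal] at h
  rw [← h]
  ext i
  simp [mulVec_diagonal]

lemma Hurwitz.isUnit_one_sub {A : Matrix n n ℝ} (hA : Hurwitz A) : IsUnit (1 - A) := by
  rw [isUnit_iff_isUnit_det, isUnit_iff_ne_zero]
  intro h
  obtain ⟨v, hv, h⟩ := exists_mulVec_eq_zero_iff.2 h
  rw [sub_mulVec, one_mulVec, sub_eq_zero] at h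
  have h1 := hA 1 (fun i => (v i : ℂ)) (by
    ext i
    have := congrFun h i
    simp only [mulVec, dotProduct] at this ⊢
    rw [Pi.smul_apply, this]
    simp) (fun h0 => hv (by ext i; simpa using congrFun h0 i))
  norm_num at h1

/-- The Cayley transform `(1 + A) (1 - A)⁻¹`. -/
noncomputable def cayley (A : Matrix n n ℝ) : Matrix n n ℝ := (1 + A) * (1 - A)⁻¹

lemma Hurwitz.cayley_mul {A : Matrix n n ℝ} (hA : Hurwitz A) :
    cayley A * (1 - A) = 1 + A := by
  rw [cayley, Matrix.mul_assoc,
    nonsing_inv_mul _ ((isUnit_iff_isUnit_det _).1 hA.isUnit_one_sub), Matrix.mul_one]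

/-- Multiplying by the conjugate of 1 + μ and taking real parts gives |1 + μ|² Re w = |μ|² - 1. If
|μ| ≥ 1 both sides vanish, so μ = -1, and then the hypothesis reads 0 = -2. -/
lemma norm_lt_one_of_re_neg {μ w : ℂ} (h : (1 + μ) * w = μ - 1) (hw : w.re < 0) :
    ‖μ‖ < 1 := by
  by_contra! hc
  have h1 : 1 ≤ μ.re * μ.re + μ.im * μ.im := by
    rw [← Complex.normSq_apply, Complex.normSq_eq_norm_sq]
    nlinarith
  have hre := congrArg Complex.re h
  have him := congrArg Complex.im h
  simp at hre him
  have key : ((1 + μ.re) ^ 2 + μ.im ^ 2) * w.re = μ.re * μ.re + μ.im * μ.im - 1 := by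
    linear_combination (1 + μ.re) * hre + μ.im * him
  have h2 : 0 ≤ (1 + μ.re) ^ 2 + μ.im ^ 2 := by positivity
  have h3 : (1 + μ.re) ^ 2 + μ.im ^ 2 = 0 := by nlinarith
  have h4 : μ.re = -1 := by nlinarith [sq_nonneg (1 + μ.re), sq_nonneg μ.im]
  have h5 : μ.im = 0 := by nlinarith [sq_nonneg (1 + μ.re), sq_nonneg μ.im]
  rw [h4, h5] at hre
  norm_num at hre

/-- The Cayley transform carries the left half-plane into the unit disc, so its powers decay; they
play the role of the matrix exponential. -/
lemma Hurwitz.tendsto_cayley_pow {A : Matrix n n ℝ} (hA : Hurwitz A) :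
    Filter.Tendsto (fun k : ℕ => cayley A ^ k) Filter.atTop (nhds 0) := by
  let φ := algebraMap ℝ ℂ
  have hC : (cayley A).map φ * (1 - A.map φ) = 1 + A.map φ := by
    have := congrArg (fun M : Matrix n n ℝ => φ.mapMatrix M) hA.cayley_mul
    simpa only [map_mul, map_add, map_sub, map_one, RingHom.mapMatrix_apply] using this
  have hU : IsUnit (1 - A.map φ) := by
    have := hA.isUnit_one_sub.map φ.mapMatrix
    simpa only [map_sub, map_one, RingHom.mapMatrix_apply] using this
  have key : ∀ z ∈ spectrum ℂ ((cayley A).map φ), ‖z‖ < 1 := by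
    intro μ hμ
    obtain ⟨w, hw, h⟩ := exists_eigenvector_of_mem_spectrum hμ
    set y := (1 - A.map φ)⁻¹ *ᵥ w with hy
    have hyw : (1 - A.map φ) *ᵥ y = w := by
      rw [hy, mulVec_mulVec, mul_nonsing_inv _ ((isUnit_iff_isUnit_det _).1 hU), one_mulVec]
    have hy0 : y ≠ 0 := by
      intro h0
      rw [h0, mulVec_zero] at hyw
      exact hw hyw.symm
    rw [← hyw, mulVec_mulVec, hC, add_mulVec, sub_mulVec, one_mulVec] at h
    have h' : (1 + μ) • (A.map φ *ᵥ y) = (μ - 1) • y := by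
      rw [smul_sub] at h
      rw [add_smul, sub_smul, one_smul, one_smul]
      linear_combination (exp := 1) h
    have hμ1 : 1 + μ ≠ 0 := by
      intro h0
      rw [h0, zero_smul] at h'
      rcases smul_eq_zero.1 h'.symm with h1 | h1
      · have : (2 : ℂ) = 0 := by linear_combination h0 - h1
        norm_num at this
      · exact hy0 h1
    have h2 : A.map φ *ᵥ y = ((μ - 1) / (1 + μ)) • y := by
      rw [div_eq_inv_mul, mul_smul, ← h', smul_smul, inv_mul_cancel₀ hμ1, one_smul]
    exact norm_lt_one_of_re_neg (mul_div_cancel₀ _ hμ1) (hA _ y h2 hy0)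
  have h := tendsto_pow_of_spectrum_lt_one _ key
  refine tendsto_pi_nhds.2 fun i => tendsto_pi_nhds.2 fun j => ?_
  have h1 := ((tendsto_pi_nhds.1 ((tendsto_pi_nhds.1 h) i)) j)
  have h2 := (Complex.continuous_re.tendsto _).comp h1
  refine Filter.Tendsto.congr (fun k => ?_) h2
  have : (cayley A).map φ ^ k = (cayley A ^ k).map φ := (map_pow φ.mapMatrix _ _).symm
  simp only [Function.comp, this]
  simp [φ]

/-- Turns the Lyapunov operator into a discrete one, so that iteration replaces integration over
time. -/
lemma Hurwitz.stein {A X : Matrix n n ℝ} (hA : Hurwitz A) :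
    X - (cayley A)ᵀ * X * cayley A =
      ((1 - A)⁻¹)ᵀ * ((-2 : ℝ) • (Aᵀ * X + X * A)) * (1 - A)⁻¹ := by
  have h1 : (1 - A) * (1 - A)⁻¹ = 1 :=
    mul_nonsing_inv _ ((isUnit_iff_isUnit_det _).1 hA.isUnit_one_sub)
  have h2 : ((1 - A)⁻¹)ᵀ * (1 - A)ᵀ = 1 := by rw [← transpose_mul, h1, transpose_one]
  have h3 : X = ((1 - A)⁻¹)ᵀ * ((1 - A)ᵀ * X * (1 - A)) * (1 - A)⁻¹ := by
    simp only [Matrix.mul_assoc, h1, Matrix.mul_one]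
    rw [← Matrix.mul_assoc, h2, Matrix.one_mul]
  have h4 : (1 - A)ᵀ * X * (1 - A) - (1 + A)ᵀ * X * (1 + A) = (-2 : ℝ) • (Aᵀ * X + X * A) := by
    simp only [transpose_sub, transpose_add, transpose_one, neg_smul, two_smul]
    noncomm_ring
  rw [← h4, Matrix.mul_sub, Matrix.sub_mul, ← h3, cayley, transpose_mul]
  simp only [Matrix.mul_assoc]

lemma Hurwitz.tendsto_congruence {A : Matrix n n ℝ} (hA : Hurwitz A) (X : Matrix n n ℝ) :
    Filter.Tendsto (fun k : ℕ => (cayley A ^ k)ᵀ * X * cayley A ^ k) Filter.atTop (nhds 0) := by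
  have hc : Continuous fun S : Matrix n n ℝ => Sᵀ * X * S := by fun_prop
  have h := (hc.tendsto 0).comp hA.tendsto_cayley_pow
  rwa [Matrix.mul_zero] at h

lemma posSemidef_of_tendsto {n : Type*} [Fintype n] {ι : Type*} {l : Filter ι} [l.NeBot] {f : ι → Matrix n n ℝ}
    {X : Matrix n n ℝ} (hf : Filter.Tendsto f l (nhds X)) (h : ∀ k, (f k).PosSemidef) :
    X.PosSemidef := by
  refine PosSemidef.of_dotProduct_mulVec_nonneg ?_ fun x => ?_
  · have hc : Continuous fun S : Matrix n n ℝ => Sᴴ := by fun_prop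
    exact tendsto_nhds_unique ((hc.tendsto X).comp hf) (hf.congr fun k => (h k).1.symm)
  · have hc : Continuous fun S : Matrix n n ℝ => star x ⬝ᵥ (S *ᵥ x) := by fun_prop
    exact ge_of_tendsto' ((hc.tendsto X).comp hf) fun k => (h k).dotProduct_mulVec_nonneg x

/-- The difference between `X` and its congruence by the k-th Cayley power telescopes into positive
semidefinite terms, and the congruence tends to zero. -/
lemma Hurwitz.posSemidef_of_lyapunov {A X Q : Matrix n n ℝ} (hA : Hurwitz A)
    (hQ : Q.PosSemidef) (h : Aᵀ * X + X * A + Q = 0) : X.PosSemidef := by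
  have hD : (X - (cayley A)ᵀ * X * cayley A).PosSemidef := by
    have h1 : (-2 : ℝ) • (Aᵀ * X + X * A) = (2 : ℝ) • Q := by
      rw [eq_neg_of_add_eq_zero_left h, smul_neg, neg_smul, neg_neg]
    rw [hA.stein, h1]
    exact (hQ.smul zero_le_two).conjTranspose_mul_mul_same _
  have hk : ∀ k : ℕ, (X - (cayley A ^ k)ᵀ * X * cayley A ^ k).PosSemidef := by
    intro k
    induction k with
    | zero => simpa using PosSemidef.zero
    | succ k ih =>
      have h2 := ih.add (hD.conjTranspose_mul_mul_same (cayley A ^ k))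
      convert h2 using 1
      rw [pow_succ', transpose_mul, conjTranspose_eq_transpose_of_trivial]
      noncomm_ring
  refine posSemidef_of_tendsto (l := Filter.atTop) ?_ hk
  simpa using tendsto_const_nhds.sub (hA.tendsto_congruence X)

lemma Hurwitz.eq_zero_of_lyapunov {A X : Matrix n n ℝ} (hA : Hurwitz A)
    (h : Aᵀ * X + X * A = 0) : X = 0 := by
  have hD : (cayley A)ᵀ * X * cayley A = X := by
    have := hA.stein (X := X)
    rw [h, smul_zero, Matrix.mul_zero, Matrix.zero_mul, sub_eq_zero] at this
    exact this.symm
  have hk : ∀ k : ℕ, (cayley A ^ k)ᵀ * X * cayley A ^ k = X := by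
    intro k
    induction k with
    | zero => simp
    | succ k ih =>
      calc (cayley A ^ (k + 1))ᵀ * X * cayley A ^ (k + 1)
          = (cayley A ^ k)ᵀ * ((cayley A)ᵀ * X * cayley A) * cayley A ^ k := by
            rw [pow_succ', transpose_mul]
            simp only [Matrix.mul_assoc]
        _ = X := by rw [hD, ih]
  have := hA.tendsto_congruence X
  simp only [hk] at this
  exact tendsto_nhds_unique tendsto_const_nhds this

/-- The Lyapunov operator is injective on a finite-dimensional space, hence surjective. -/
lemma Hurwitz.exists_lyapunov {A : Matrix n n ℝ} (hA : Hurwitz A) {Q : Matrix n n ℝ}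
    (hQ : Q.PosSemidef) : ∃ X : Matrix n n ℝ, X.PosSemidef ∧ Aᵀ * X + X * A + Q = 0 := by
  let L : Matrix n n ℝ →ₗ[ℝ] Matrix n n ℝ :=
    LinearMap.mulLeft ℝ Aᵀ + LinearMap.mulRight ℝ A
  have hL : Function.Injective L := by
    rw [← LinearMap.ker_eq_bot, LinearMap.ker_eq_bot']
    exact fun X hX => hA.eq_zero_of_lyapunov hX
  obtain ⟨X, hX⟩ := LinearMap.injective_iff_surjective.1 hL (-Q)
  have hX' : Aᵀ * X + X * A + Q = 0 := by
    rw [show Aᵀ * X + X * A = -Q from hX, neg_add_cancel]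
  exact ⟨X, hA.posSemidef_of_lyapunov hQ hX', hX'⟩

lemma exists_transpose_mul_self {X : Matrix n n ℝ} (hX : X.PosSemidef) :
    ∃ Y : Matrix n n ℝ, X = Yᵀ * Y := by
  open scoped MatrixOrder in
  obtain ⟨Y, rfl⟩ := CStarAlgebra.nonneg_iff_eq_star_mul_self.mp hX.nonneg
  exact ⟨Y, rfl⟩

/-- The complexification of a real matrix. -/
noncomputable abbrev toComplex {p m : Type*} (K : Matrix p m ℝ) : Matrix p m ℂ :=
  K.map (algebraMap ℝ ℂ)

lemma toComplex_transpose {p m : Type*} (K : Matrix p m ℝ) :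
    toComplex Kᵀ = (toComplex K)ᴴ := by
  ext i j
  simp

lemma toComplex_mul {p q m : Type*} [Fintype q] (K : Matrix p q ℝ) (L : Matrix q m ℝ) :
    toComplex (K * L) = toComplex K * toComplex L :=
  Matrix.map_mul

lemma toComplex_add {p m : Type*} (K L : Matrix p m ℝ) :
    toComplex (K + L) = toComplex K + toComplex L :=
  Matrix.map_add _ (map_add _) K L

lemma star_dotProduct_self {q : Type*} [Fintype q] (x : q → ℂ) :
    star x ⬝ᵥ x = ((∑ i, ‖x i‖ ^ 2 : ℝ) : ℂ) := by
  simp [dotProduct, ← Complex.conj_mul']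

lemma star_dotProduct_gram_mulVec {q n : Type*} [Fintype q] [Fintype n]
    (K : Matrix q n ℂ) (x y : n → ℂ) :
    star x ⬝ᵥ ((Kᴴ * K) *ᵥ y) = star (K *ᵥ x) ⬝ᵥ (K *ᵥ y) := by
  rw [star_mulVec, ← mulVec_mulVec, dotProduct_mulVec]

/-- An eigenvector of `A` with unstable eigenvalue is invisible to every output accounted for in
a Lyapunov equation that has a positive semidefinite solution. -/
lemma mulVec_eq_zero_of_lyapunov {q : Type*} [Fintype q] {A X Q : Matrix n n ℝ}
    (hX : X.PosSemidef) (hQ : Q.PosSemidef) {W : Matrix q n ℝ}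
    (h : Aᵀ * X + X * A + (Wᵀ * W + Q) = 0) {z : ℂ} {v : n → ℂ}
    (hv : toComplex A *ᵥ v = z • v) (hz : 0 ≤ z.re) : toComplex W *ᵥ v = 0 := by
  obtain ⟨Y, rfl⟩ := exists_transpose_mul_self hX
  obtain ⟨V, rfl⟩ := exists_transpose_mul_self hQ
  have h1 := congrArg toComplex h
  simp only [toComplex_add, toComplex_mul, toComplex_transpose] at h1
  have h2 := congrArg (fun M => star v ⬝ᵥ (M *ᵥ v)) h1
  have e1 : star v ⬝ᵥ (((toComplex A)ᴴ * ((toComplex Y)ᴴ * toComplex Y)) *ᵥ v) =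
      star z * (star (toComplex Y *ᵥ v) ⬝ᵥ (toComplex Y *ᵥ v)) := by
    rw [← mulVec_mulVec, dotProduct_mulVec, ← star_mulVec, hv, star_dotProduct_gram_mulVec,
      mulVec_smul, star_smul, smul_dotProduct, smul_eq_mul]
  have e2 : star v ⬝ᵥ (((toComplex Y)ᴴ * toComplex Y * toComplex A) *ᵥ v) =
      z * (star (toComplex Y *ᵥ v) ⬝ᵥ (toComplex Y *ᵥ v)) := by
    rw [← mulVec_mulVec, hv, star_dotProduct_gram_mulVec, mulVec_smul, dotProduct_smul,
      smul_eq_mul]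
  have e3 : toComplex (0 : Matrix n n ℝ) = 0 := Matrix.map_zero _ (map_zero _)
  simp only [add_mulVec, dotProduct_add, e1, e2, e3, star_dotProduct_gram_mulVec, zero_mulVec,
    dotProduct_zero, star_dotProduct_self] at h2
  -- The real part reads 2 Re z ‖Yv‖² + ‖Wv‖² + ‖Vv‖² = 0, with every term nonnegative.
  have hre := congrArg Complex.re h2
  simp only [Complex.add_re, Complex.mul_re, Complex.star_def, Complex.conj_re, Complex.ofReal_re,
    Complex.ofReal_im, Complex.zero_re, mul_zero, sub_zero] at hre
  have p1 : 0 ≤ ∑ i, ‖(toComplex Y *ᵥ v) i‖ ^ 2 := by positivity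
  have p2 : 0 ≤ ∑ i, ‖(toComplex W *ᵥ v) i‖ ^ 2 := by positivity
  have p3 : 0 ≤ ∑ i, ‖(toComplex V *ᵥ v) i‖ ^ 2 := by positivity
  have p4 : ∑ i, ‖(toComplex W *ᵥ v) i‖ ^ 2 = 0 := by nlinarith [mul_nonneg hz p1]
  ext i
  have := (Finset.sum_eq_zero_iff_of_nonneg fun i _ => by positivity).1 p4 i (Finset.mem_univ i)
  simpa using this

end Lyapunov

/-! ### Kleinman's iteration for the Riccati equation with E = 1. -/

section Kleinman

variable {n q m : Type*} [Fintype n] [DecidableEq n] [Fintype q] [Fintype m] [DecidableEq m]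
  {A : Matrix n n ℝ} {B : Matrix n m ℝ} {C : Matrix q n ℝ} {D : Matrix q m ℝ}

lemma posSemidef_transpose_mul_self {q n : Type*} [Fintype q] [Fintype n] (K : Matrix q n ℝ) :
    (Kᵀ * K).PosSemidef := by
  rw [← conjTranspose_eq_transpose_of_trivial]
  exact posSemidef_conjTranspose_mul_self K

omit [DecidableEq n] [DecidableEq m] in
/-- Completion of squares in the Lyapunov equation of the closed loop with feedback `F`. -/
lemma lyapunov_eq_of_gain {X : Matrix n n ℝ} {F K : Matrix m n ℝ} (hX : Xᵀ = X)
    (hK : Dᵀ * D * K = -(Bᵀ * X + Dᵀ * C)) :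
    (A + B * F)ᵀ * X + X * (A + B * F) + (C + D * F)ᵀ * (C + D * F) =
      (A + B * K)ᵀ * X + X * (A + B * K) + (C + D * K)ᵀ * (C + D * K) +
        (D * (F - K))ᵀ * (D * (F - K)) := by
  -- The gain equation trades every product of `B` with `X` for terms in `C`, `D` and `K`, after
  -- which the two sides agree term by term.
  have h1 : Bᵀ * X = -(Dᵀ * D * K) - Dᵀ * C := by rw [hK]; abel
  have h2 : X * B = -(Kᵀ * (Dᵀ * D)) - Cᵀ * D := by
    have := congrArg transpose h1
    simpa [transpose_mul, hX] using this
  have h3 : ∀ L : Matrix m n ℝ, Lᵀ * Bᵀ * X = -(Lᵀ * (Dᵀ * (D * K))) - Lᵀ * (Dᵀ * C) := by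
    intro L
    rw [Matrix.mul_assoc, h1, Matrix.mul_sub, Matrix.mul_neg]
    simp only [Matrix.mul_assoc]
  have h4 : ∀ L : Matrix m n ℝ, X * (B * L) = -(Kᵀ * (Dᵀ * (D * L))) - Cᵀ * (D * L) := by
    intro L
    rw [← Matrix.mul_assoc, h2, Matrix.sub_mul, Matrix.neg_mul]
    simp only [Matrix.mul_assoc]
  simp only [transpose_add, transpose_mul, Matrix.add_mul, Matrix.mul_add, h3, h4,
    Matrix.mul_sub, transpose_sub, Matrix.sub_mul, Matrix.mul_assoc]
  abel

/-- `X` is the positive semidefinite cost of the stabilizing feedback `F`. -/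
structure IsCost (A : Matrix n n ℝ) (B : Matrix n m ℝ) (C : Matrix q n ℝ) (D : Matrix q m ℝ)
    (F : Matrix m n ℝ) (X : Matrix n n ℝ) : Prop where
  hurwitz : Hurwitz (A + B * F)
  posSemidef : X.PosSemidef
  lyapunov : (A + B * F)ᵀ * X + X * (A + B * F) + (C + D * F)ᵀ * (C + D * F) = 0

/-- The feedback `-(Dᵀ D)⁻¹ (Bᵀ X + Dᵀ C)`. -/
noncomputable def gain (B : Matrix n m ℝ) (C : Matrix q n ℝ) (D : Matrix q m ℝ)
    (X : Matrix n n ℝ) : Matrix m n ℝ :=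
  -((Dᵀ * D)⁻¹ * (Bᵀ * X + Dᵀ * C))

omit [DecidableEq n] in
lemma gain_spec (hD : IsUnit (Dᵀ * D)) (X : Matrix n n ℝ) :
    Dᵀ * D * gain B C D X = -(Bᵀ * X + Dᵀ * C) := by
  rw [gain, Matrix.mul_neg, mul_nonsing_inv_cancel_left _ _ ((isUnit_iff_isUnit_det _).1 hD)]

omit [DecidableEq n] [DecidableEq m] in
lemma toComplex_mulVec_of_feedback {q' : Type*} (K : Matrix q' n ℝ) (L : Matrix q' m ℝ)
    (F : Matrix m n ℝ) (v : n → ℂ) : toComplex (K + L * F) *ᵥ v =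
      toComplex K *ᵥ v + toComplex L *ᵥ (toComplex F *ᵥ v) := by
  rw [toComplex_add, toComplex_mul, add_mulVec, mulVec_mulVec]

/-- One step of the Kleinman iteration. -/
lemma IsCost.exists_next (hD : IsUnit (Dᵀ * D)) {F : Matrix m n ℝ} {X : Matrix n n ℝ}
    (h : IsCost A B C D F X) :
    ∃ Y, IsCost A B C D (gain B C D X) Y ∧ (X - Y).PosSemidef := by
  set K := gain B C D X with hKdef
  have hK := gain_spec (B := B) (C := C) hD X
  rw [← hKdef] at hK
  have hX : Xᵀ = X := h.posSemidef.1
  have h1 := lyapunov_eq_of_gain (A := A) (F := F) hX hK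
  rw [h.lyapunov] at h1
  have hS := posSemidef_transpose_mul_self (D * (F - K))
  -- On an unstable eigenvector of A + BK the output D(F - K) vanishes. As DᵀD is invertible, F and
  -- K agree there, so A + BF has the same unstable eigenvalue.
  have hurw : Hurwitz (A + B * K) := by
    intro z v hv hv0
    by_contra! hz
    have h2 := mulVec_eq_zero_of_lyapunov h.posSemidef (posSemidef_transpose_mul_self (C + D * K))
      (W := D * (F - K)) (A := A + B * K) (z := z) (v := v) (by rw [h1]; abel) hv hz
    have h3 : toComplex (F - K) *ᵥ v = 0 := by
      have h4 : F - K = (Dᵀ * D)⁻¹ * (Dᵀ * (D * (F - K))) := by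
        rw [← Matrix.mul_assoc Dᵀ, nonsing_inv_mul_cancel_left _ _
          ((isUnit_iff_isUnit_det _).1 hD)]
      rw [h4, toComplex_mul, toComplex_mul, ← mulVec_mulVec, ← mulVec_mulVec, h2, mulVec_zero,
        mulVec_zero]
    have h5 : toComplex (A + B * F) *ᵥ v = z • v := by
      have h6 : A + B * F = A + B * K + B * (F - K) := by rw [Matrix.mul_sub]; abel
      rw [h6, toComplex_mulVec_of_feedback, h3, mulVec_zero, add_zero]
      exact hv
    exact absurd (h.hurwitz z v h5 hv0) (not_lt.2 hz)
  obtain ⟨Y, hY, hYl⟩ := hurw.exists_lyapunov (posSemidef_transpose_mul_self (C + D * K))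
  -- Subtracting the two Lyapunov equations for A + BK leaves one for X - Y with forcing term (D(F -
  -- K))ᵀ(D(F - K)).
  refine ⟨Y, ⟨hurw, hY, hYl⟩, hurw.posSemidef_of_lyapunov hS ?_⟩
  rw [Matrix.mul_sub, Matrix.sub_mul]
  calc _ = ((A + B * K)ᵀ * X + X * (A + B * K) + (C + D * K)ᵀ * (C + D * K) +
          (D * (F - K))ᵀ * (D * (F - K))) -
          ((A + B * K)ᵀ * Y + Y * (A + B * K) + (C + D * K)ᵀ * (C + D * K)) := by abel
    _ = 0 := by rw [← h1, hYl, sub_zero]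

lemma exists_kleinman_sequence (hD : IsUnit (Dᵀ * D)) (hA : Hurwitz A) :
    ∃ X : ℕ → Matrix n n ℝ, (∀ k, (X k - X (k + 1)).PosSemidef) ∧ (∀ k, (X k).PosSemidef) ∧
      ∀ k, IsCost A B C D (gain B C D (X k)) (X (k + 1)) := by
  obtain ⟨X₀, h₀, hl₀⟩ := hA.exists_lyapunov (posSemidef_transpose_mul_self C)
  have hc : IsCost A B C D 0 X₀ := ⟨by simpa using hA, h₀, by simpa using hl₀⟩
  choose! next hnext using fun (X : Matrix n n ℝ) (h : ∃ F, IsCost A B C D F X) =>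
    h.choose_spec.exists_next hD
  let X : ℕ → Matrix n n ℝ := fun k => next^[k] X₀
  have hs : ∀ k, X (k + 1) = next (X k) := fun k => Function.iterate_succ_apply' next k X₀
  have hX : ∀ k, ∃ F, IsCost A B C D F (X k) := by
    intro k
    induction k with
    | zero => exact ⟨0, hc⟩
    | succ k ih => exact hs k ▸ ⟨_, (hnext _ ih).1⟩
  exact ⟨X, fun k => hs k ▸ (hnext _ (hX k)).2, fun k => (hX k).choose_spec.posSemidef,
    fun k => hs k ▸ (hnext _ (hX k)).1⟩

/-- Monotonicity controls only quadratic forms; this recovers the entries from them. -/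
lemma dotProduct_mulVec_polarization {X : Matrix n n ℝ} (hX : Xᵀ = X) (i j : n) :
    X i j = ((Pi.single i 1 + Pi.single j 1 : n → ℝ) ⬝ᵥ (X *ᵥ (Pi.single i 1 + Pi.single j 1)) -
      (Pi.single i 1 : n → ℝ) ⬝ᵥ (X *ᵥ Pi.single i 1) -
      (Pi.single j 1 : n → ℝ) ⬝ᵥ (X *ᵥ Pi.single j 1)) / 2 := by
  have h : X j i = X i j := congrFun (congrFun hX i) j
  simp [mulVec_add, add_dotProduct, dotProduct_add, h]
  ring

/-- A decreasing sequence of positive semidefinite matrices converges. -/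
lemma exists_tendsto_of_antitone {X : ℕ → Matrix n n ℝ}
    (hX : ∀ k, (X k - X (k + 1)).PosSemidef) (h0 : ∀ k, (X k).PosSemidef) :
    ∃ Y, Filter.Tendsto X Filter.atTop (nhds Y) := by
  have h1 : ∀ x : n → ℝ, ∃ l,
      Filter.Tendsto (fun k => x ⬝ᵥ (X k *ᵥ x)) Filter.atTop (nhds l) := by
    intro x
    refine ⟨_, tendsto_atTop_ciInf (antitone_nat_of_succ_le fun k => ?_)
      ⟨0, Set.forall_mem_range.2 fun k => ?_⟩⟩
    · have := (hX k).dotProduct_mulVec_nonneg x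
      simpa [sub_mulVec, dotProduct_sub] using this
    · simpa using (h0 k).dotProduct_mulVec_nonneg x
  choose l hl using h1
  refine ⟨fun i j => (l (Pi.single i 1 + Pi.single j 1) - l (Pi.single i 1) -
    l (Pi.single j 1)) / 2, tendsto_pi_nhds.2 fun i => tendsto_pi_nhds.2 fun j => ?_⟩
  exact ((((hl _).sub (hl (Pi.single i 1))).sub (hl (Pi.single j 1))).div_const 2).congr
    fun k => (dotProduct_mulVec_polarization (h0 k).1 i j).symm

/-- The Riccati equation has a positive semidefinite solution. -/
lemma exists_posSemidef_lyapunov_gain (hD : IsUnit (Dᵀ * D)) (hA : Hurwitz A) :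
    ∃ X : Matrix n n ℝ, X.PosSemidef ∧
      (A + B * gain B C D X)ᵀ * X + X * (A + B * gain B C D X) +
        (C + D * gain B C D X)ᵀ * (C + D * gain B C D X) = 0 := by
  obtain ⟨X, h1, h2, h3⟩ := exists_kleinman_sequence (B := B) (C := C) hD hA
  obtain ⟨Y, hY⟩ := exists_tendsto_of_antitone h1 h2
  refine ⟨Y, posSemidef_of_tendsto hY h2, ?_⟩
  have hc : Continuous fun P : Matrix n n ℝ × Matrix n n ℝ =>
      (A + B * gain B C D P.1)ᵀ * P.2 + P.2 * (A + B * gain B C D P.1) +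
        (C + D * gain B C D P.1)ᵀ * (C + D * gain B C D P.1) := by
    unfold gain
    fun_prop
  -- Each equation involves two consecutive iterates, the earlier one through its gain; both tend to
  -- `Y`, which closes the equation up.
  have h4 := (hc.tendsto (Y, Y)).comp
    (hY.prodMk_nhds ((Filter.tendsto_add_atTop_iff_nat 1).2 hY))
  exact tendsto_nhds_unique h4 (tendsto_const_nhds.congr fun k => (h3 k).lyapunov.symm)

/-- If `(A, B, C, D)` has no zeros in the closed right half-plane, then the Riccati equation has
a stabilizing positive semidefinite solution. -/
lemma exists_stabilizing_posSemidef (hD : IsUnit (Dᵀ * D)) (hA : Hurwitz A)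
    (hzero : ∀ (z : ℂ) (v : n → ℂ) (u : m → ℂ), 0 ≤ z.re →
      toComplex A *ᵥ v + toComplex B *ᵥ u = z • v →
      toComplex C *ᵥ v + toComplex D *ᵥ u = 0 → v = 0) :
    ∃ X : Matrix n n ℝ, IsCost A B C D (gain B C D X) X := by
  obtain ⟨X, hX, h⟩ := exists_posSemidef_lyapunov_gain (B := B) (C := C) hD hA
  refine ⟨X, fun z v hv hv0 => ?_, hX, h⟩
  by_contra! hz
  -- An unstable closed-loop eigenvector has zero output by the Lyapunov equation, so with the input
  -- u = Kv it is a zero of the system.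
  refine hv0 (hzero z v (toComplex (gain B C D X) *ᵥ v) hz ?_ ?_)
  · rw [← toComplex_mulVec_of_feedback]
    exact hv
  · rw [← toComplex_mulVec_of_feedback]
    exact mulVec_eq_zero_of_lyapunov hX PosSemidef.zero (by rw [add_zero]; exact h) hv hz

end Kleinman

/-! ### From a stable left inverse to a stabilizing solution, for invertible E. -/

section Riccati

variable {n q m : Type*} [Fintype n] [DecidableEq n] [Fintype q] [Fintype m] [DecidableEq m]
  {A E : Matrix n n ℝ} {B : Matrix n m ℝ} {C : Matrix q n ℝ} {D : Matrix q m ℝ}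

/-- Factor A - zE = E(E⁻¹A - z). Regularity is automatic, because the leading coefficient of det(sE
- A) is det E. -/
lemma isStablePencil_iff_hurwitz (hE : IsUnit E) : IsStablePencil A E ↔ Hurwitz (E⁻¹ * A) := by
  have hdet := (isUnit_iff_isUnit_det E).1 hE
  have hA : toComplex A = toComplex E * toComplex (E⁻¹ * A) := by
    rw [← toComplex_mul, mul_nonsing_inv_cancel_left _ _ hdet]
  have hinv : toComplex E⁻¹ * toComplex E = 1 := by
    rw [← toComplex_mul, nonsing_inv_mul _ hdet]
    exact Matrix.map_one _ (map_zero _) (map_one _)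
  have key : ∀ (z : ℂ) (v : n → ℂ),
      (toComplex A - z • toComplex E) *ᵥ v = 0 ↔ toComplex (E⁻¹ * A) *ᵥ v = z • v := by
    intro z v
    have h : (toComplex A - z • toComplex E) *ᵥ v =
        toComplex E *ᵥ (toComplex (E⁻¹ * A) *ᵥ v - z • v) := by
      rw [hA, sub_mulVec, mulVec_sub, mulVec_mulVec, smul_mulVec, mulVec_smul]
    rw [h]
    constructor
    · intro h0
      have := congrArg (toComplex E⁻¹ *ᵥ ·) h0
      simpa only [mulVec_mulVec, hinv, one_mulVec, mulVec_zero, sub_eq_zero] using this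
    · intro h0
      rw [h0, sub_self, mulVec_zero]
  constructor
  · intro h z v hv hv0
    exact coe_mem_openLHP.1 (h.2 (Or.inl ⟨z, rfl,
      exists_mulVec_eq_zero_iff.1 ⟨v, hv0, (key z v).2 hv⟩⟩))
  · intro h
    refine ⟨fun h0 => ?_, ?_⟩
    · have hneg : A.map (Polynomial.C : ℝ →+* ℝ[X]) - (X : ℝ[X]) • E.map Polynomial.C =
          -polyPencil A E := by
        ext1 i j
        simp [polyPencil]
        ring
      rw [hneg, det_neg] at h0
      have h1 := (mul_eq_zero.1 h0).resolve_left (by simp)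
      have h2 := coeff_det_X_add_C_card E (-A)
      rw [polyPencil] at h1
      rw [h1, coeff_zero] at h2
      exact hdet.ne_zero h2.symm
    · rintro w (⟨z, rfl, hz⟩ | ⟨rfl, h0⟩)
      · obtain ⟨v, hv0, hv⟩ := exists_mulVec_eq_zero_iff.2 hz
        exact coe_mem_openLHP.2 (h z v ((key z v).1 hv) hv0)
      · exact absurd h0 hdet.ne_zero

lemma realize_eq {n p m : Type*} [Fintype n] [DecidableEq n] {A E : Matrix n n ℝ}
    {B : Matrix n m ℝ} {C : Matrix p n ℝ} {D : Matrix p m ℝ} :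
    realize A E B C D = const C * (pencil A E)⁻¹ * const B + const D := rfl

omit [Fintype m] [DecidableEq m] in
lemma IsStablePencil.isStable_realize {p : Type*} (hA : IsStablePencil A E) (hE : IsUnit E)
    (C : Matrix p n ℝ) (D : Matrix p m ℝ) : IsStable (realize A E B C D) :=
  (((isStable_const C).mul (hA.isStable_inv hE)).mul (isStable_const B)).add (isStable_const D)

/-- A realization whose transfer function matrix has a stable left inverse has no zeros in the
closed right half-plane. -/
lemma eq_zero_of_leftInverse (hE : IsUnit E) (hA : IsStablePencil A E) {L : TFM m q}
    (hL : IsStable L) (h : L * realize A E B C D = 1) {z : ℂ} (hz : 0 ≤ z.re) {v : n → ℂ}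
    {u : m → ℂ} (hv : toComplex A *ᵥ v + toComplex B *ᵥ u = z • (toComplex E *ᵥ v))
    (hu : toComplex C *ᵥ v + toComplex D *ᵥ u = 0) : v = 0 := by
  have hΦ := hA.isStable_inv hE
  have h1 : evalMatrix z (pencil A E)⁻¹ * evalMatrix z (pencil A E) = 1 := by
    rw [← evalMatrix_mul (hΦ.mem_regularAt hz) (pencil_mem_regularAt z),
      nonsing_inv_mul _ ((isUnit_iff_isUnit_det _).1 hA.isUnit_pencil), evalMatrix_one]
  have hT : evalMatrix z (realize A E B C D) =
      toComplex C * evalMatrix z (pencil A E)⁻¹ * toComplex B + toComplex D := by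
    have h2 := (isStable_const C).mul hΦ
    rw [realize_eq, evalMatrix_add ((h2.mul (isStable_const B)).mem_regularAt hz)
        (const_mem_regularAt z D),
      evalMatrix_mul (h2.mem_regularAt hz) (const_mem_regularAt z B),
      evalMatrix_mul (const_mem_regularAt z C) (hΦ.mem_regularAt hz)]
    simp only [evalMatrix_const]
  -- The state is determined by the input through the resolvent at z, so it suffices to show u = 0.
  have hv' : v = evalMatrix z (pencil A E)⁻¹ *ᵥ (toComplex B *ᵥ u) := by
    have h3 : evalMatrix z (pencil A E) *ᵥ v = toComplex B *ᵥ u := by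
      rw [evalMatrix_pencil, sub_mulVec, smul_mulVec, ← hv, add_sub_cancel_left]
    rw [← h3, mulVec_mulVec, h1, one_mulVec]
  have hTu : evalMatrix z (realize A E B C D) *ᵥ u = 0 := by
    rw [hT, add_mulVec, ← mulVec_mulVec, ← mulVec_mulVec, ← hv', hu]
  have h4 := congrArg (evalMatrix z) h
  rw [evalMatrix_mul (hL.mem_regularAt hz) ((hA.isStable_realize hE C D).mem_regularAt hz),
    evalMatrix_one] at h4
  have hu0 : u = 0 := by
    rw [← one_mulVec u, ← h4, ← mulVec_mulVec, hTu, mulVec_zero]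
  rw [hv', hu0, mulVec_zero, mulVec_zero]

/-- A stable left inverse of the realization yields a stabilizing Riccati solution. -/
lemma exists_isStabilizingSolution (hE : IsUnit E) (hA : IsStablePencil A E)
    (hD : IsUnit (Dᵀ * D)) {L : TFM m q} (hL : IsStable L) (h : L * realize A E B C D = 1) :
    ∃ X, IsStabilizingSolution A E B C D X := by
  have hdet := (isUnit_iff_isUnit_det E).1 hE
  have hAc : toComplex E * toComplex (E⁻¹ * A) = toComplex A := by
    rw [← toComplex_mul, mul_nonsing_inv_cancel_left _ _ hdet]
  have hBc : toComplex E * toComplex (E⁻¹ * B) = toComplex B := by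
    rw [← toComplex_mul, mul_nonsing_inv_cancel_left _ _ hdet]
  obtain ⟨X, hX⟩ := exists_stabilizing_posSemidef (A := E⁻¹ * A) (B := E⁻¹ * B) (C := C) hD
    ((isStablePencil_iff_hurwitz hE).1 hA) (by
      intro z v u hz hv hu
      refine eq_zero_of_leftInverse hE hA hL h hz ?_ hu
      rw [← mulVec_smul, ← hv, mulVec_add, mulVec_mulVec, mulVec_mulVec, hAc, hBc])
  set K := gain (E⁻¹ * B) C D X with hK
  have hXs : Xᵀ = X := hX.posSemidef.1
  have hT : Eᵀ * (E⁻¹)ᵀ = 1 := by rw [← transpose_mul, nonsing_inv_mul _ hdet, transpose_one]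
  have hXE : (E⁻¹)ᵀ * X * E⁻¹ * E = (E⁻¹)ᵀ * X := nonsing_inv_mul_cancel_right _ _ hdet
  have hfb : feedback E B C D ((E⁻¹)ᵀ * X * E⁻¹) = K := by
    rw [hK, feedback, gain, Matrix.mul_assoc Bᵀ, hXE, transpose_mul, Matrix.mul_assoc Bᵀ]
  -- This congruence undoes the passage to E⁻¹A and E⁻¹B while leaving the feedback unchanged.
  refine ⟨(E⁻¹)ᵀ * X * E⁻¹, ?_, ?_, ?_⟩
  · rw [IsSymm, transpose_mul, transpose_mul, transpose_transpose, hXs, Matrix.mul_assoc]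
  · have h1 := lyapunov_eq_of_gain (A := E⁻¹ * A) (F := 0) hXs
      (gain_spec (B := E⁻¹ * B) (C := C) hD X)
    rw [← hK, hX.lyapunov] at h1
    have hKt : Kᵀ = -((X * (E⁻¹ * B) + Cᵀ * D) * (Dᵀ * D)⁻¹) := by
      rw [hK, gain, transpose_neg, transpose_mul, transpose_nonsing_inv]
      simp only [transpose_add, transpose_mul, transpose_transpose, hXs]
    have h2 : (D * (0 - K))ᵀ * (D * (0 - K)) =
        (X * (E⁻¹ * B) + Cᵀ * D) * (Dᵀ * D)⁻¹ * ((E⁻¹ * B)ᵀ * X + Dᵀ * C) := by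
      have h3 := gain_spec (B := E⁻¹ * B) (C := C) hD X
      rw [← hK] at h3
      calc (D * (0 - K))ᵀ * (D * (0 - K)) = Kᵀ * (Dᵀ * D * K) := by
            simp [transpose_mul, Matrix.mul_assoc]
        _ = _ := by rw [h3, hKt, Matrix.mul_neg, Matrix.neg_mul, neg_neg]
    have e1 : Eᵀ * ((E⁻¹)ᵀ * X * E⁻¹) * A = X * (E⁻¹ * A) := by
      rw [Matrix.mul_assoc, Matrix.mul_assoc, Matrix.mul_assoc, ← Matrix.mul_assoc Eᵀ, hT,
        Matrix.one_mul]
    have e2 : Aᵀ * ((E⁻¹)ᵀ * X * E⁻¹) * E = (E⁻¹ * A)ᵀ * X := by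
      rw [Matrix.mul_assoc Aᵀ, hXE, transpose_mul, Matrix.mul_assoc]
    have e3 : Eᵀ * ((E⁻¹)ᵀ * X * E⁻¹) * B = X * (E⁻¹ * B) := by
      rw [Matrix.mul_assoc, Matrix.mul_assoc, Matrix.mul_assoc, ← Matrix.mul_assoc Eᵀ, hT,
        Matrix.one_mul]
    have e4 : Bᵀ * ((E⁻¹)ᵀ * X * E⁻¹) * E = (E⁻¹ * B)ᵀ * X := by
      rw [Matrix.mul_assoc Bᵀ, hXE, transpose_mul, Matrix.mul_assoc]
    rw [GCARE, e1, e2, e3, e4, ← h2, sub_eq_zero, ← zero_add ((D * (0 - K))ᵀ * _), ← h1]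
    simp only [Matrix.mul_zero, add_zero]
    abel
  · rw [hfb, isStablePencil_iff_hurwitz hE, Matrix.mul_add, ← Matrix.mul_assoc]
    exact hX.hurwitz

end Riccati

/-! ### Constant matrices and para-conjugation. -/

section Const

variable {p q m : Type*}

lemma const_mul [Fintype q] (K : Matrix p q ℝ) (L : Matrix q m ℝ) :
    const (K * L) = const K * const L := Matrix.map_mul

lemma const_add (K L : Matrix p m ℝ) : const (K + L) = const K + const L :=
  Matrix.map_add _ (map_add _) K L

lemma const_neg (K : Matrix p m ℝ) : const (-K) = -const K := by
  ext i j
  simp [const]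

lemma const_one [DecidableEq m] : const (1 : Matrix m m ℝ) = 1 :=
  Matrix.map_one _ (map_zero _) (map_one _)

lemma negArg_C (r : ℝ) : negArg (RatFunc.C r) = RatFunc.C r :=
  negArg.commutes r

lemma negArg_X : negArg RatFunc.X = -RatFunc.X := by
  have := RatFunc.map_apply_div (Polynomial.algEquivAevalNegX : ℝ[X] ≃ₐ[ℝ] ℝ[X]).toAlgHom
    (nonZeroDivisors_le_comap_nonZeroDivisors_of_injective _
      (Polynomial.algEquivAevalNegX : ℝ[X] ≃ₐ[ℝ] ℝ[X]).injective) X 1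
  simp only [map_one, div_one, RatFunc.algebraMap_X] at this
  refine this.trans ?_
  simp [RatFunc.algebraMap_X]

/-- The para-conjugate `Gᵀ(-s)` of `G(s)`. -/
noncomputable def paraconj (G : TFM p m) : TFM m p := (G.map negArg)ᵀ

lemma paraconj_mul [Fintype q] (G : TFM p q) (K : TFM q m) :
    paraconj (G * K) = paraconj K * paraconj G := by
  rw [paraconj, Matrix.map_mul, transpose_mul]
  rfl

lemma paraconj_add (G K : TFM p m) : paraconj (G + K) = paraconj G + paraconj K := by
  ext i j
  simp [paraconj]

lemma paraconj_one [DecidableEq m] : paraconj (1 : TFM m m) = 1 := by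
  rw [paraconj, Matrix.map_one _ (map_zero _) (map_one _), transpose_one]

lemma paraconj_const (K : Matrix p m ℝ) : paraconj (const K) = const Kᵀ := by
  ext i j
  simp [paraconj, const, negArg_C]

lemma paraconj_pencil (A E : Matrix p p ℝ) : paraconj (pencil A E) =
    -((RatFunc.X : RatFunc ℝ) • const Eᵀ) - const Aᵀ := by
  ext i j
  simp [paraconj, pencil, const, negArg_C, negArg_X]

lemma paraconj_fromRows_mul_self [Fintype p] [Fintype q] (G : TFM p m) (K : TFM q m) :
    paraconj (fromRows G K) * fromRows G K = paraconj G * G + paraconj K * K := by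
  have h : paraconj (fromRows G K) = fromCols (paraconj G) (paraconj K) := by
    ext i (j | j) <;> rfl
  rw [h, fromCols_mul_fromRows]

end Const

/-! ### The spectral factor and its inverse. -/

section SpectralFactor

variable {n q m : Type*} [Fintype n] [DecidableEq n] [Fintype q] [Fintype m] [DecidableEq m]
  {A E : Matrix n n ℝ} {B : Matrix n m ℝ} {C : Matrix q n ℝ} {D : Matrix q m ℝ}
  {X : Matrix n n ℝ} {F : Matrix m n ℝ} {H : Matrix m m ℝ}

/-- The inverse of `1 - F (s E - A)⁻¹ B` is `1 + F (s E - A - B F)⁻¹ B`. -/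
lemma realize_mul_realize_closedLoop (hA : IsStablePencil A E)
    (hF : IsStablePencil (A + B * F) E) (hH : IsUnit H) :
    realize A E B (-(H * F)) H * (realize (A + B * F) E B F 1 * const H⁻¹) = 1 := by
  have h1 := nonsing_inv_mul _ ((isUnit_iff_isUnit_det _).1 hA.isUnit_pencil)
  have h2 := mul_nonsing_inv _ ((isUnit_iff_isUnit_det _).1 hF.isUnit_pencil)
  -- The two pencils differ by BF, which gives the resolvent identity `h5`.
  have h3 : const B * const F = pencil A E - pencil (A + B * F) E := by
    rw [pencil, pencil, const_add, const_mul]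
    abel
  have h4 : const H * const H⁻¹ = 1 := by
    rw [← const_mul, mul_nonsing_inv _ ((isUnit_iff_isUnit_det _).1 hH), const_one]
  set Φ := (pencil A E)⁻¹
  set Ψ := (pencil (A + B * F) E)⁻¹
  have h5 : Φ * (const B * const F) * Ψ = Ψ - Φ := by
    rw [h3, Matrix.mul_sub, h1, Matrix.sub_mul, Matrix.one_mul, Matrix.mul_assoc, h2,
      Matrix.mul_one]
  have h6 : (1 - const F * Φ * const B) * (const F * Ψ * const B + 1) = 1 := by
    have : const F * Φ * const B * (const F * Ψ * const B) =
        const F * (Φ * (const B * const F) * Ψ) * const B := by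
      simp only [Matrix.mul_assoc]
    rw [Matrix.sub_mul, Matrix.one_mul, Matrix.mul_add, this, h5, Matrix.mul_sub, Matrix.sub_mul]
    simp
  rw [realize_eq, realize_eq, const_one, const_neg, const_mul]
  have h7 : -(const H * const F) * Φ * const B + const H =
      const H * (1 - const F * Φ * const B) := by
    rw [Matrix.mul_sub, Matrix.mul_one]
    simp only [Matrix.neg_mul, Matrix.mul_assoc]
    abel
  rw [h7, ← Matrix.mul_assoc, Matrix.mul_assoc (const H), h6, Matrix.mul_one, h4]

omit [DecidableEq m] [Fintype m] in
lemma paraconj_realize_mul_self (C : Matrix q n ℝ) (D : Matrix q m ℝ) :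
    paraconj (realize A E B C D) * realize A E B C D =
      const Bᵀ * (paraconj (pencil A E)⁻¹ * const (Cᵀ * C) * (pencil A E)⁻¹) * const B +
        const Bᵀ * paraconj (pencil A E)⁻¹ * const (Cᵀ * D) +
          const (Dᵀ * C) * (pencil A E)⁻¹ * const B + const (Dᵀ * D) := by
  rw [realize_eq, paraconj_add, paraconj_mul, paraconj_mul]
  simp only [paraconj_const, Matrix.add_mul, Matrix.mul_add, const_mul, Matrix.mul_assoc]
  abel

/-- The Riccati equation provides a spectral factorization. -/
lemma paraconj_realize_mul_realize (hA : IsStablePencil A E) (hX : X.IsSymm)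
    (hG : GCARE A E B C D X) (hD : IsUnit (Dᵀ * D)) (hF : F = feedback E B C D X)
    (hH : Hᵀ * H = Dᵀ * D) :
    paraconj (realize A E B C D) * realize A E B C D =
      paraconj (realize A E B (-(H * F)) H) * realize A E B (-(H * F)) H := by
  have hRF : Dᵀ * C = -(Dᵀ * D * F) - Bᵀ * X * E := by
    rw [hF, feedback, Matrix.mul_neg, neg_neg,
      mul_nonsing_inv_cancel_left _ _ ((isUnit_iff_isUnit_det _).1 hD)]
    abel
  have hFR : Cᵀ * D = -(Fᵀ * (Dᵀ * D)) - Eᵀ * X * B := by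
    have := congrArg transpose hRF
    simpa [transpose_mul, hX.eq, Matrix.mul_assoc] using this
  have hCC : Cᵀ * C = Fᵀ * (Dᵀ * D) * F - Eᵀ * X * A - Aᵀ * X * E := by
    have h1 : (Eᵀ * X * B + Cᵀ * D) * (Dᵀ * D)⁻¹ * (Bᵀ * X * E + Dᵀ * C) =
        Fᵀ * (Dᵀ * D) * F := by
      rw [hFR, hRF, add_sub_cancel, add_sub_cancel, Matrix.neg_mul,
        mul_nonsing_inv_cancel_right _ _ ((isUnit_iff_isUnit_det _).1 hD), Matrix.neg_mul,
        Matrix.mul_neg, neg_neg, ← Matrix.mul_assoc]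
    rw [GCARE, h1, sub_eq_zero] at hG
    rw [← hG]
    abel
  have hP := mul_nonsing_inv _ ((isUnit_iff_isUnit_det _).1 hA.isUnit_pencil)
  set Φ := (pencil A E)⁻¹ with hΦ
  have hQ : paraconj Φ * paraconj (pencil A E) = 1 := by
    rw [← paraconj_mul, hP, paraconj_one]
  -- The terms in s cancel, so the constant Lyapunov part of the Riccati equation can be written
  -- with the pencil and its para-conjugate.
  have hmid : const Eᵀ * const X * pencil A E + paraconj (pencil A E) * const X * const E =
      -(const (Eᵀ * X * A)) - const (Aᵀ * X * E) := by
    rw [paraconj_pencil, pencil]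
    simp only [Matrix.mul_sub, Matrix.sub_mul, Matrix.neg_mul, Matrix.smul_mul, Matrix.mul_smul,
      ← const_mul]
    abel
  -- Each pencil cancels a neighbouring resolvent; the leftover single-resolvent terms are later
  -- absorbed by the cross terms in CᵀD and DᵀC.
  have hfirst : paraconj Φ * const (Cᵀ * C) * Φ = paraconj Φ * const (Fᵀ * (Dᵀ * D) * F) * Φ +
      (paraconj Φ * const (Eᵀ * X) + const (X * E) * Φ) := by
    have h1 : const (Cᵀ * C) = const (Fᵀ * (Dᵀ * D) * F) +
        (const Eᵀ * const X * pencil A E + paraconj (pencil A E) * const X * const E) := by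
      rw [hmid, hCC, sub_eq_add_neg, sub_eq_add_neg, const_add, const_add, const_neg, const_neg]
      abel
    have h2 : paraconj Φ * (const Eᵀ * const X * pencil A E) * Φ = paraconj Φ * const (Eᵀ * X) := by
      rw [Matrix.mul_assoc, Matrix.mul_assoc _ (pencil A E), hP, Matrix.mul_one, const_mul]
    have h3 : paraconj Φ * (paraconj (pencil A E) * const X * const E) * Φ = const (X * E) * Φ := by
      rw [Matrix.mul_assoc (paraconj (pencil A E)), ← Matrix.mul_assoc (paraconj Φ), hQ,
        Matrix.one_mul, const_mul]
    rw [h1, Matrix.mul_add, Matrix.add_mul, Matrix.mul_add, Matrix.add_mul, h2, h3]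
  have e1 : (-(H * F))ᵀ * -(H * F) = Fᵀ * (Dᵀ * D) * F := by
    rw [← hH, transpose_neg, transpose_mul]
    simp only [Matrix.neg_mul, Matrix.mul_neg, neg_neg, Matrix.mul_assoc]
  have e2 : (-(H * F))ᵀ * H = -(Fᵀ * (Dᵀ * D)) := by
    rw [← hH, transpose_neg, transpose_mul, Matrix.neg_mul, Matrix.mul_assoc]
  have e3 : Hᵀ * -(H * F) = -(Dᵀ * D * F) := by
    rw [← hH, Matrix.mul_neg, Matrix.mul_assoc]
  rw [paraconj_realize_mul_self, paraconj_realize_mul_self, ← hΦ, e1, e2, e3, hH, hfirst, hFR, hRF,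
    sub_eq_add_neg, sub_eq_add_neg, const_add, const_add, const_neg (Eᵀ * X * B),
    const_neg (Bᵀ * X * E)]
  simp only [const_mul, Matrix.add_mul, Matrix.mul_add, Matrix.neg_mul, Matrix.mul_neg,
    Matrix.mul_assoc]
  abel

end SpectralFactor

/-! ### Normalization and the main theorem. -/

/-- Since `G₀` and its inverse `K` are both stable, multiplying the Bezout identity by `G₀` on the
left and `K` on the right gives stable Bezout factors for the new pair. -/
lemma IsStableRCF.normalize {p m : Type*} [Fintype p] [Fintype m] [DecidableEq m]
    {G N : TFM p m} {M G₀ K : TFM m m} (h : IsStableRCF G N M) (hG₀ : IsStable G₀)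
    (hK : IsStable K) (hGK : G₀ * K = 1)
    (hT : paraconj (fromRows N M) * fromRows N M = paraconj G₀ * G₀) :
    IsUnit G₀ ∧ IsStableNRCF G (N * G₀⁻¹) (M * G₀⁻¹) := by
  have hinv : G₀⁻¹ = K := inv_eq_right_inv hGK
  have hKG : K * G₀ = 1 := mul_eq_one_comm.1 hGK
  have hKu : IsUnit K := ⟨⟨K, G₀, hKG, hGK⟩, rfl⟩
  obtain ⟨Xt, Yt, hX, hY, hXY⟩ := h.coprime
  refine ⟨⟨⟨G₀, K, hGK, hKG⟩, rfl⟩, ?_⟩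
  rw [hinv]
  refine ⟨⟨h.stable_num.mul hK, h.stable_den.mul hK, ?_, ?_, G₀ * Xt, G₀ * Yt, hG₀.mul hX,
    hG₀.mul hY, ?_⟩, ?_⟩
  · rw [det_mul]
    exact mul_ne_zero h.det_den_ne_zero ((isUnit_iff_isUnit_det K).1 hKu).ne_zero
  · rw [Matrix.mul_inv_rev, ← Matrix.mul_assoc, Matrix.mul_assoc N,
      mul_nonsing_inv _ ((isUnit_iff_isUnit_det K).1 hKu), Matrix.mul_one]
    exact h.factorization
  · calc G₀ * Yt * (M * K) - G₀ * Xt * (N * K) = G₀ * (Yt * M - Xt * N) * K := by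
          simp only [Matrix.mul_sub, Matrix.sub_mul, Matrix.mul_assoc]
      _ = 1 := by rw [hXY, Matrix.mul_one, hGK]
  · change paraconj (N * K) * (N * K) + paraconj (M * K) * (M * K) = 1
    rw [paraconj_fromRows_mul_self] at hT
    calc _ = paraconj K * (paraconj N * N + paraconj M * M) * K := by
          simp only [paraconj_mul, Matrix.mul_add, Matrix.add_mul, Matrix.mul_assoc]
      _ = paraconj (G₀ * K) * (G₀ * K) := by
          rw [hT, paraconj_mul]
          simp only [Matrix.mul_assoc]
      _ = 1 := by rw [hGK, paraconj_one, Matrix.one_mul]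

end Descriptor

theorem lemma1 {n p m : ℕ}
    (Ar Er : Matrix (Fin n) (Fin n) ℝ) (Br : Matrix (Fin n) (Fin m) ℝ)
    (Cr : Matrix (Fin p ⊕ Fin m) (Fin n) ℝ) (Dr : Matrix (Fin p ⊕ Fin m) (Fin m) ℝ)
    (hE : IsUnit Er) (hA : Descriptor.IsStablePencil Ar Er)
    (G N : Descriptor.TFM (Fin p) (Fin m)) (M : Descriptor.TFM (Fin m) (Fin m))
    (hreal : Matrix.fromRows N M = Descriptor.realize Ar Er Br Cr Dr)
    (hRCF : Descriptor.IsStableRCF G N M)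
    (Hr : Matrix (Fin m) (Fin m) ℝ) (hH : IsUnit Hr)
    (hHD : Matrix.transpose Hr * Hr = Matrix.transpose Dr * Dr) :
    (∃ Xr : Matrix (Fin n) (Fin n) ℝ,
      Descriptor.IsStabilizingSolution Ar Er Br Cr Dr Xr) ∧
    (∀ Xr : Matrix (Fin n) (Fin n) ℝ,
      Descriptor.IsStabilizingSolution Ar Er Br Cr Dr Xr →
      ∀ (Fr : Matrix (Fin m) (Fin n) ℝ), Fr = Descriptor.feedback Er Br Cr Dr Xr →
      ∀ (G₀ : Descriptor.TFM (Fin m) (Fin m)),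
        G₀ = Descriptor.realize Ar Er Br (-(Hr * Fr)) Hr →
        IsUnit G₀ ∧ Descriptor.IsStableNRCF G (N * G₀⁻¹) (M * G₀⁻¹)) := by
  have hD : IsUnit (Drᵀ * Dr) := by
    rw [← hHD]
    exact ((isUnit_transpose Hr).2 hH).mul hH
  refine ⟨?_, ?_⟩
  · obtain ⟨Xt, Yt, hX, hY, hXY⟩ := hRCF.coprime
    -- The Bezout factors, placed side by side, form the stable left inverse.
    refine Descriptor.exists_isStabilizingSolution hE hA hD (L := fromCols (-Xt) Yt) ?_ ?_
    · rw [Descriptor.isStable_iff] at hX hY ⊢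
      rintro i (j | j)
      · exact neg_mem (hX i j)
      · exact hY i j
    · rw [← hreal, fromCols_mul_fromRows, Matrix.neg_mul, neg_add_eq_sub, hXY]
  · rintro Xr hXr Fr hFr G₀ rfl
    have hF : Descriptor.IsStablePencil (Ar + Br * Fr) Er := hFr ▸ hXr.stabilizing
    refine hRCF.normalize (hA.isStable_realize hE _ _)
      ((hF.isStable_realize hE _ _).mul (Descriptor.isStable_const Hr⁻¹))
      (Descriptor.realize_mul_realize_closedLoop hA hF hH) ?_
    rw [hreal]
    exact Descriptor.paraconj_realize_mul_realize hA hXr.symm hXr.solves hD hFr hHD
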